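/- Let $k$ be a field and let $\mathcal{H}$ be a simple hypergraph with finite vertex set $V=V(\mathcal{H})$ and edge set $\mathcal{E}(\mathcal{H})$, that is, $\mathcal{E}(\mathcal{H})$ is a family of subsets of $V$ none of which contains another. A set of vertices is *independent* if it contains no edge; the independent sets are the faces of the independence complex $\Delta_{\mathcal{H}}$ on the vertex set $V$. Let $R=k[x_v : v\in V]$ and let $I_{\Delta_{\mathcal{H}}}\subseteq R$ be the Stanley–Reisner ideal, generated by the monomials $\prod_{v\in F}x_v$ with $F\subseteq V$, $F\notin\Delta_{\mathcal{H}}$. A simplicial complex $\Delta$ on a vertex set $V$ (a family of subsets of $V$ closed under taking subsets, possibly without any face; vertices $x$ with $\{x\}\notin\Delta$ are allowed) is *vertex decomposable* if either its only facet is $V$, or $\Delta=\emptyset$, or there is $x\in V$ such that the deletion $\{F\in\Delta : x\notin F\}$ and the link $\{F : x\notin F,\ F\cup\{x\}\in\Delta\}$, both on the vertex set $V\setminus\{x\}$, are vertex decomposable and every facet of the deletion is a facet of $\Delta$. The hypergraph $\mathcal{H}$ is vertex decomposable if $\Delta_{\mathcal{H}}$ is. A *bouquet* of $\mathcal{H}$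 is a nonempty set $B$ of edges of $\mathcal{H}$ (its *stems*) with $\bigcap_{E\in B}E\neq\emptyset$, together with a set of *roots*: if $B$ has at least two stems, the roots are the elements of $\bigcap_{E\in B}E$; if $B=\{E\}$, the roots are the elements of a chosen proper subset of $E$, which has to be nonempty if $|E|\geq 2$. The *flowers* of $B$ are the elements of $\bigcup_{E\in B}E$ that are not roots. For a set $\mathcal{B}$ of bouquets of $\mathcal{H}$ with pairwise distinct sets of stems, let $F(\mathcal{B})$ and $R(\mathcal{B})$ be the sets of vertices that are a flower, respectively a root, of some bouquet in $\mathcal{B}$. The set $\mathcal{B}$ is *semi-strongly disjoint* if $R(\mathcal{B})$ is independent, and $$d'_{\mathcal{H}}:=\max\{|F(\mathcal{B})| : \mathcal{B}\text{ is a semi-strongly disjoint set of bouquets of }\mathcal{H}\}$$ (with $d'_{\mathcal{H}}:=0$ if $\emptyset\in\mathcal{E}(\mathcal{H})$, when there is no such $\mathcal{B}$). **Theorem.** If $\mathcal{H}$ is vertex decomposable, then the projective dimension of the $R$-module $R/I_{\Delta_{\mathcal{H}}}$ satisfies $$\operatorname{pd}(R/I_{\Delta_{\mathcal{H}}})\leq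 d'_{\mathcal{H}}.$$ (The projective dimension of the zero module is $-\infty$.) -/

import Mathlib

/-- A simplicial complex on the vertex set `vertices`: a family of subsets of `vertices` closed under
taking subsets.  The void complex (no face at all) and the complex `{∅}` are both allowed, and a
vertex `x` need not satisfy `{x} ∈ faces`. -/
@[ext]
structure SimpComplex (α : Type*) where
  vertices : Set α
  faces : Set (Set α)
  subset_vertices : ∀ F ∈ faces, F ⊆ vertices
  down_closed : ∀ F ∈ faces, ∀ G, G ⊆ F → G ∈ faces

namespace SimpComplex

/-- The facets of a complex are its faces that are maximal with respect to inclusion. -/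
def facets {α : Type*} (Δ : SimpComplex α) : Set (Set α) :=
  {F | Maximal (fun G => G ∈ Δ.faces) F}

/-- The deletion of `x`, on the vertex set `V ∖ {x}`: the faces that avoid `x`. -/
def del {α : Type*} (Δ : SimpComplex α) (x : α) : SimpComplex α where
  vertices := Δ.vertices \ {x}
  faces := {F | F ∈ Δ.faces ∧ x ∉ F}
  subset_vertices := fun F hF =>
    Set.subset_sdiff_singleton (Δ.subset_vertices F hF.1) hF.2
  down_closed := fun _ hF _ hGF =>
    ⟨Δ.down_closed _ hF.1 _ hGF, fun hx => hF.2 (hGF hx)⟩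

/-- The link of `x`, on the vertex set `V ∖ {x}`: the sets `F` avoiding `x` such that `F ∪ {x}` is
a face. -/
def link {α : Type*} (Δ : SimpComplex α) (x : α) : SimpComplex α where
  vertices := Δ.vertices \ {x}
  faces := {F | x ∉ F ∧ insert x F ∈ Δ.faces}
  subset_vertices := fun F hF =>
    Set.subset_sdiff_singleton
      ((Set.subset_insert x F).trans (Δ.subset_vertices _ hF.2)) hF.1
  down_closed := fun _ hF _ hGF =>
    ⟨fun hx => hF.1 (hGF hx),
      Δ.down_closed _ hF.2 _ (Set.insert_subset_insert hGF)⟩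

/-- A shedding vertex: a vertex `x` such that every facet of the deletion of `x` is a facet. -/
def IsSheddingVertex {α : Type*} (Δ : SimpComplex α) (x : α) : Prop :=
  x ∈ Δ.vertices ∧ ∀ F ∈ (Δ.del x).facets, F ∈ Δ.facets

/-- Vertex decomposability: the only facet is the whole vertex set, or the complex has no face, or
there is a shedding vertex whose deletion and link are both vertex decomposable. -/
inductive VertexDecomposable {α : Type*} : SimpComplex α → Prop
  | simplex (Δ : SimpComplex α) (h : Δ.facets = {Δ.vertices}) : VertexDecomposable Δ
  | void (Δ : SimpComplex α) (h : Δ.faces = ∅) : VertexDecomposable Δ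
  | shed (Δ : SimpComplex α) (x : α) (hx : Δ.IsSheddingVertex x)
      (hdel : VertexDecomposable (Δ.del x)) (hlink : VertexDecomposable (Δ.link x)) :
      VertexDecomposable Δ

/-- The Stanley-Reisner ideal in the polynomial ring over `k` whose variables are the vertices: it is
generated by the squarefree monomials `∏_{v ∈ F} x_v` of the nonfaces `F`. -/
noncomputable def stanleyReisnerIdeal {α : Type*} (Δ : SimpComplex α) (k : Type*) [Field k] :
    Ideal (MvPolynomial Δ.vertices k) :=
  Ideal.span {m | ∃ F : Finset Δ.vertices,
    Subtype.val '' (F : Set Δ.vertices) ∉ Δ.faces ∧ m = ∏ v ∈ F, MvPolynomial.X v}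

end SimpComplex

namespace Hypergraph

/-- A hypergraph is simple if no edge contains another one. -/
def IsSimple {α : Type*} (H : Hypergraph α) : Prop :=
  IsAntichain (fun E E' : Set α => E ⊆ E') H.edgeSet

/-- A set of vertices is independent if it contains no edge. -/
def IsIndep {α : Type*} (H : Hypergraph α) (S : Set α) : Prop :=
  S ⊆ H.vertexSet ∧ ∀ E ∈ H.edgeSet, ¬ E ⊆ S

/-- The independence complex: its faces are the independent sets of vertices. -/
def independenceComplex {α : Type*} (H : Hypergraph α) : SimpComplex α where
  vertices := H.vertexSet
  faces := {S | H.IsIndep S}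
  subset_vertices := fun _ hS => hS.1
  down_closed := fun _ hS _ hTS =>
    ⟨hTS.trans hS.1, fun E hE hET => hS.2 E hE (hET.trans hTS)⟩

/-- A hypergraph is vertex decomposable if its independence complex is. -/
def IsVertexDecomposable {α : Type*} (H : Hypergraph α) : Prop :=
  H.independenceComplex.VertexDecomposable

/-- A bouquet of `H`, given by its set of stems: a nonempty set of edges of `H` with a common
vertex. -/
def IsBouquet {α : Type*} (H : Hypergraph α) (B : Set (Set α)) : Prop :=
  B ⊆ H.edgeSet ∧ B.Nonempty ∧ (⋂₀ B).Nonempty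

/-- `R` is an admissible set of roots of the bouquet with set of stems `B`.  If there are at least
two stems, the roots are the common vertices of all the stems.  If there is only one stem `E`, the
roots are any proper subset of `E`; it has to be nonempty, except if `E` has only one element (then
`∅` is the only proper subset). -/
def IsRootSet {α : Type*} (B : Set (Set α)) (R : Set α) : Prop :=
  (B.Nontrivial ∧ R = ⋂₀ B) ∨
    ∃ E, B = {E} ∧ R ⊂ E ∧ (R.Nonempty ∨ ∃ x, E = {x})

/-- A set `bouquets` of bouquets of `H`, together with the choice of the roots of each of them. -/
structure BouquetSet {α : Type*} (H : Hypergraph α) where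
  bouquets : Set (Set (Set α))
  root : Set (Set α) → Set α
  isBouquet : ∀ B ∈ bouquets, H.IsBouquet B
  isRootSet : ∀ B ∈ bouquets, IsRootSet B (root B)

/-- The vertices that are a root of some bouquet of the set. -/
def BouquetSet.roots {α : Type*} {H : Hypergraph α} (𝓑 : H.BouquetSet) : Set α :=
  ⋃ B ∈ 𝓑.bouquets, 𝓑.root B

/-- The vertices that are a flower of some bouquet of the set: the flowers of a bouquet are the
vertices on its stems that are not among its roots. -/
def BouquetSet.flowers {α : Type*} {H : Hypergraph α} (𝓑 : H.BouquetSet) : Set α :=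
  ⋃ B ∈ 𝓑.bouquets, (⋃₀ B \ 𝓑.root B)

/-- A set of bouquets is semi-strongly disjoint if its set of roots is independent. -/
def BouquetSet.SemiStronglyDisjoint {α : Type*} {H : Hypergraph α} (𝓑 : H.BouquetSet) : Prop :=
  H.IsIndep 𝓑.roots

/-- The invariant `d'_H`: the maximal number of flowers of a semi-strongly disjoint set of bouquets.
For a finite vertex set the numbers in question are bounded by the number of vertices.  If `∅` is an
edge there is no semi-strongly disjoint set of bouquets, and the value is `0`. -/
noncomputable def dPrime {α : Type*} (H : Hypergraph α) : ℕ :=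
  sSup {n | ∃ 𝓑 : H.BouquetSet, 𝓑.SemiStronglyDisjoint ∧ n = 𝓑.flowers.ncard}

end Hypergraph

/-! For a vertex decomposable complex, the projective dimension of `R/I` is at most the largest size
of a facet complement `V \ F`; and every facet complement of the independence complex is the flower
set of a semi-strongly disjoint set of bouquets. The first bound is induction on the decomposition,
via `0 → R/(I : x) → R/I → R/(I + (x)) → 0` for a shedding vertex `x`. Here `(I : x)` comes from the
link, and `I + (x)` is the deletion ideal plus a variable regular modulo it, which costs one.
Shedding pays for it: a facet of the deletion is a facet of the complex, whose complement also
contains `x`. The ring stays fixed while vertices are removed, hence `nonfaceIdeal V`. -/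

open CategoryTheory

/-! ### Colon ideals and projective dimension -/

/-- The short exact sequence `0 → R/J → R/I → R/K → 0` with `J = (I : x)` and `K = I + (x)`. -/
theorem exists_shortExact_colon {R : Type*} [CommRing R] {I J K : Ideal R} {x : R}
    (hJ : ∀ a, x * a ∈ I ↔ a ∈ J) (hK : K = I ⊔ Ideal.span {x}) :
    ∃ S : ShortComplex (ModuleCat R), S.ShortExact ∧ S.X₁ = ModuleCat.of R (R ⧸ J) ∧
      S.X₂ = ModuleCat.of R (R ⧸ I) ∧ S.X₃ = ModuleCat.of R (R ⧸ K) := by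
  have hIK : I ≤ K := hK ▸ le_sup_left
  have hxK : x ∈ K := hK ▸ Ideal.mem_sup_right (Ideal.mem_span_singleton_self x)
  let f : (R ⧸ J) →ₗ[R] (R ⧸ I) :=
    Submodule.mapQ J I (LinearMap.mulLeft R x) fun a ha => (hJ a).2 ha
  let g : (R ⧸ I) →ₗ[R] (R ⧸ K) := Submodule.mapQ I K LinearMap.id fun a ha => hIK ha
  have hf : ∀ a : R, f (Submodule.Quotient.mk a) = Submodule.Quotient.mk (x * a) := fun a => rfl
  have hg : ∀ a : R, g (Submodule.Quotient.mk a) = Submodule.Quotient.mk a := fun a => rfl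
  have hinj : Function.Injective f := by
    rw [injective_iff_map_eq_zero]
    intro q hq
    obtain ⟨a, rfl⟩ := Submodule.Quotient.mk_surjective J q
    rw [hf, Submodule.Quotient.mk_eq_zero] at hq
    exact (Submodule.Quotient.mk_eq_zero J).2 ((hJ a).1 hq)
  have hsurj : Function.Surjective g := by
    intro q
    obtain ⟨a, rfl⟩ := Submodule.Quotient.mk_surjective K q
    exact ⟨Submodule.Quotient.mk a, hg a⟩
  have hex : Function.Exact f g := by
    intro q
    obtain ⟨a, rfl⟩ := Submodule.Quotient.mk_surjective I q
    rw [hg, Submodule.Quotient.mk_eq_zero]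
    constructor
    · intro ha
      rw [hK, sup_comm, Ideal.mem_span_singleton_sup] at ha
      obtain ⟨b, c, hc, rfl⟩ := ha
      refine ⟨Submodule.Quotient.mk b, ?_⟩
      rw [hf, Submodule.Quotient.eq]
      have : x * b - (b * x + c) = -c := by ring
      rw [this]
      exact I.neg_mem hc
    · rintro ⟨r, hr⟩
      obtain ⟨b, rfl⟩ := Submodule.Quotient.mk_surjective J r
      rw [hf, Submodule.Quotient.eq] at hr
      have := K.sub_mem (K.mul_mem_right b hxK) (hIK hr)
      simpa using this
  refine ⟨ShortComplex.mk (ModuleCat.ofHom f) (ModuleCat.ofHom g) ?_, ?_, rfl, rfl, rfl⟩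
  · exact ModuleCat.hom_ext (LinearMap.ext hex.apply_apply_eq_zero)
  · have := (ModuleCat.mono_iff_injective (ModuleCat.ofHom f)).2 hinj
    have := (ModuleCat.epi_iff_surjective (ModuleCat.ofHom g)).2 hsurj
    exact { exact := (ShortComplex.ShortExact.moduleCat_exact_iff_function_exact _).2 hex }

theorem hasProjectiveDimensionLT_of_colon {R : Type*} [CommRing R] {I J K : Ideal R} {x : R}
    (hJ : ∀ a, x * a ∈ I ↔ a ∈ J) (hK : K = I ⊔ Ideal.span {x}) {n : ℕ}
    (h₁ : HasProjectiveDimensionLT (ModuleCat.of R (R ⧸ J)) n)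
    (h₃ : HasProjectiveDimensionLT (ModuleCat.of R (R ⧸ K)) n) :
    HasProjectiveDimensionLT (ModuleCat.of R (R ⧸ I)) n := by
  obtain ⟨S, hS, e₁, e₂, e₃⟩ := exists_shortExact_colon hJ hK
  rw [← e₁] at h₁
  rw [← e₃] at h₃
  rw [← e₂]
  exact hS.hasProjectiveDimensionLT_X₂ n h₁ h₃

/-- Adding a nonzerodivisor modulo `I` to `I` raises the projective dimension by at most one. -/
theorem hasProjectiveDimensionLT_sup_span_singleton {R : Type*} [CommRing R] {I : Ideal R} {x : R}
    (hx : ∀ a, x * a ∈ I ↔ a ∈ I) {n : ℕ}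
    (h : HasProjectiveDimensionLT (ModuleCat.of R (R ⧸ I)) n) :
    HasProjectiveDimensionLT (ModuleCat.of R (R ⧸ (I ⊔ Ideal.span {x}))) (n + 1) := by
  obtain ⟨S, hS, e₁, e₂, e₃⟩ := exists_shortExact_colon hx rfl
  rw [← e₃]
  exact hS.hasProjectiveDimensionLT_X₃ n (e₁ ▸ h)
    (e₂ ▸ hasProjectiveDimensionLT_of_ge _ n (n + 1) n.le_succ)

/-! ### Stanley–Reisner ideals of links and deletions -/

namespace SimpComplex

/-- The extension of the Stanley-Reisner ideal of `Δ` to the polynomial ring whose variables are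
the elements of `V`. -/
noncomputable def nonfaceIdeal {α : Type*} (V : Set α) (Δ : SimpComplex α) (k : Type*) [Field k] :
    Ideal (MvPolynomial V k) :=
  Ideal.span {m | ∃ F : Finset V, Subtype.val '' (F : Set V) ⊆ Δ.vertices ∧
    Subtype.val '' (F : Set V) ∉ Δ.faces ∧ m = ∏ v ∈ F, MvPolynomial.X v}

variable {α : Type*} {V : Set α} {Δ : SimpComplex α} {k : Type*} [Field k]

theorem stanleyReisnerIdeal_eq_nonfaceIdeal (Δ : SimpComplex α) (k : Type*) [Field k] :
    Δ.stanleyReisnerIdeal k = nonfaceIdeal Δ.vertices Δ k := by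
  unfold stanleyReisnerIdeal nonfaceIdeal
  congr 1
  ext m
  constructor
  · rintro ⟨F, hF, rfl⟩
    exact ⟨F, by rintro _ ⟨v, -, rfl⟩; exact v.2, hF, rfl⟩
  · rintro ⟨F, -, hF, rfl⟩
    exact ⟨F, hF, rfl⟩

/-- A polynomial lies in the ideal iff the support of each of its monomials is a nonface. -/
theorem mem_nonfaceIdeal_iff {f : MvPolynomial V k} :
    f ∈ nonfaceIdeal V Δ k ↔
      ∀ m ∈ f.support, Subtype.val '' (m.support : Set V) ∩ Δ.vertices ∉ Δ.faces := by
  classical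
  have hspan : nonfaceIdeal V Δ k = Ideal.span ((fun s => MvPolynomial.monomial s (1 : k)) ''
      {s | ∃ F : Finset V, Subtype.val '' (F : Set V) ⊆ Δ.vertices ∧
        Subtype.val '' (F : Set V) ∉ Δ.faces ∧ s = ∑ v ∈ F, Finsupp.single v 1}) := by
    unfold nonfaceIdeal
    congr 1
    ext p
    constructor
    · rintro ⟨F, h₁, h₂, rfl⟩
      exact ⟨_, ⟨F, h₁, h₂, rfl⟩, MvPolynomial.monomial_sum_one _ _⟩
    · rintro ⟨_, ⟨F, h₁, h₂, rfl⟩, rfl⟩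
      exact ⟨F, h₁, h₂, MvPolynomial.monomial_sum_one _ _⟩
  rw [hspan, MvPolynomial.mem_ideal_span_monomial_image]
  refine forall₂_congr fun m _ => ⟨?_, fun h => ?_⟩
  · rintro ⟨_, ⟨F, h₁, h₂, rfl⟩, hle⟩ hface
    refine h₂ (Δ.down_closed _ hface _ (Set.subset_inter ?_ h₁))
    refine Set.image_mono fun v hv => ?_
    have := hle v
    rw [Finsupp.finsetSum_apply, Finset.sum_eq_single_of_mem v hv
      (fun w _ hw => Finsupp.single_eq_of_ne hw.symm), Finsupp.single_eq_same] at this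
    rw [Finset.mem_coe, Finsupp.mem_support_iff]
    omega
  · have himage : Subtype.val '' ((m.support.filter fun v => v.1 ∈ Δ.vertices : Finset V) : Set V)
        = Subtype.val '' (m.support : Set V) ∩ Δ.vertices := by
      ext a
      simp only [Finset.coe_filter, Set.mem_image, Set.mem_inter_iff, Finset.mem_coe]
      constructor
      · rintro ⟨v, ⟨h₁, h₂⟩, rfl⟩
        exact ⟨⟨v, h₁, rfl⟩, h₂⟩
      · rintro ⟨⟨v, h₁, rfl⟩, h₂⟩
        exact ⟨v, ⟨h₁, h₂⟩, rfl⟩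
    -- The squarefree monomial on the part of the support inside `Δ.vertices` is a generator
    -- dividing `m`.
    refine ⟨_, ⟨m.support.filter fun v => v.1 ∈ Δ.vertices, ?_, ?_, rfl⟩, fun v => ?_⟩
    · rw [himage]
      exact Set.inter_subset_right
    · rwa [himage]
    · rw [Finsupp.finsetSum_apply]
      simp only [Finsupp.single_apply, Finset.sum_ite_eq', Finset.mem_filter,
        Finsupp.mem_support_iff]
      split_ifs with hv
      · exact Nat.one_le_iff_ne_zero.2 hv.1
      · exact Nat.zero_le _

theorem X_mul_mem_nonfaceIdeal_iff {x : V} {f : MvPolynomial V k} :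
    MvPolynomial.X x * f ∈ nonfaceIdeal V Δ k ↔ ∀ m ∈ f.support,
      insert x.1 (Subtype.val '' (m.support : Set V)) ∩ Δ.vertices ∉ Δ.faces := by
  classical
  have hsupp : ∀ m : V →₀ ℕ, Subtype.val '' ((Finsupp.single x 1 + m).support : Set V) =
      insert x.1 (Subtype.val '' (m.support : Set V)) := by
    intro m
    rw [← Set.image_insert_eq]
    congr 1
    ext v
    by_cases hv : v = x <;> simp [hv, eq_comm]
  simp [mem_nonfaceIdeal_iff, hsupp]

theorem X_mul_mem_nonfaceIdeal_iff_link {x : V} (hx : x.1 ∈ Δ.vertices) (f : MvPolynomial V k) :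
    MvPolynomial.X x * f ∈ nonfaceIdeal V Δ k ↔ f ∈ nonfaceIdeal V (Δ.link x) k := by
  rw [X_mul_mem_nonfaceIdeal_iff, mem_nonfaceIdeal_iff]
  refine forall₂_congr fun m _ => not_congr ?_
  have : insert x.1 (Subtype.val '' (m.support : Set V)) ∩ Δ.vertices =
      insert x.1 (Subtype.val '' (m.support : Set V) ∩ (Δ.link x).vertices) := by
    rw [Set.insert_inter_of_mem hx]
    change _ = insert x.1 (_ ∩ (Δ.vertices \ {x.1}))
    rw [← Set.inter_sdiff_assoc, Set.insert_sdiff_singleton]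
  rw [this]
  exact ⟨fun h => ⟨fun hmem => hmem.2.2 rfl, h⟩, fun h => h.2⟩

/-- The variable of a non-vertex occurs in no generator, so it is regular modulo the ideal. Applied
to the deletion. -/
theorem X_mul_mem_nonfaceIdeal_iff_of_notMem {x : V} (hx : x.1 ∉ Δ.vertices)
    (f : MvPolynomial V k) :
    MvPolynomial.X x * f ∈ nonfaceIdeal V Δ k ↔ f ∈ nonfaceIdeal V Δ k := by
  rw [X_mul_mem_nonfaceIdeal_iff, mem_nonfaceIdeal_iff]
  simp_rw [Set.insert_inter_of_notMem hx]

/-- Generators of nonfaces through `x` are multiples of `X x`; the nonfaces avoiding `x` are those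
of the deletion. -/
theorem nonfaceIdeal_del_sup_span_X (Δ : SimpComplex α) (k : Type*) [Field k] (x : V) :
    nonfaceIdeal V (Δ.del x) k ⊔ Ideal.span {MvPolynomial.X x} =
      nonfaceIdeal V Δ k ⊔ Ideal.span {MvPolynomial.X x} := by
  refine le_antisymm (sup_le (Ideal.span_le.2 ?_) le_sup_right)
    (sup_le (Ideal.span_le.2 ?_) le_sup_right)
  · rintro _ ⟨F, h₁, h₂, rfl⟩
    refine Ideal.mem_sup_left (Ideal.subset_span ⟨F, fun v hv => (h₁ hv).1, fun h => ?_, rfl⟩)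
    exact h₂ ⟨h, fun hv => (h₁ hv).2 rfl⟩
  · rintro _ ⟨F, h₁, h₂, rfl⟩
    by_cases hx : x ∈ F
    · exact Ideal.mem_sup_right
        (Ideal.mem_span_singleton.2 (Finset.dvd_prod_of_mem _ hx))
    · have hx' : x.1 ∉ Subtype.val '' (F : Set V) := by
        rintro ⟨v, hv, hvx⟩
        exact hx (Subtype.ext hvx ▸ hv)
      exact Ideal.mem_sup_left (Ideal.subset_span
        ⟨F, Set.subset_sdiff_singleton h₁ hx', fun h => h₂ h.1, rfl⟩)

theorem nonfaceIdeal_eq_top_of_faces_eq_empty (h : Δ.faces = ∅) : nonfaceIdeal V Δ k = ⊤ := by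
  rw [Ideal.eq_top_iff_one]
  exact Ideal.subset_span ⟨∅, by simp, by simp [h], by simp⟩

theorem faces_eq_empty_of_facets_eq_empty (hfin : Δ.vertices.Finite) (h : Δ.facets = ∅) :
    Δ.faces = ∅ := by
  rw [Set.eq_empty_iff_forall_notMem]
  intro F hF
  have hfaces : Δ.faces.Finite := hfin.finite_subsets.subset fun G hG => Δ.subset_vertices G hG
  obtain ⟨G, -, hG⟩ := hfaces.exists_le_maximal hF
  exact Set.eq_empty_iff_forall_notMem.1 h G hG

/-- Facets of the link thus have the same complements as certain facets of `Δ`, so the bound passes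
to the link unchanged. -/
theorem insert_mem_facets_of_mem_facets_link {x : α} {F : Set α} (hF : F ∈ (Δ.link x).facets) :
    insert x F ∈ Δ.facets := by
  refine ⟨hF.prop.2, fun G hG hle => ?_⟩
  have hxG : x ∈ G := hle (Set.mem_insert x F)
  have hG' : G \ {x} ∈ (Δ.link x).faces := by
    refine ⟨fun h => h.2 rfl, ?_⟩
    rwa [Set.insert_sdiff_singleton, Set.insert_eq_of_mem hxG]
  have := hF.le_of_ge hG' (Set.subset_sdiff_singleton ((Set.subset_insert x F).trans hle) hF.prop.1)
  exact Set.sdiff_singleton_subset_iff.1 this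

theorem hasProjectiveDimensionLT_zero_of_faces_eq_empty (h : Δ.faces = ∅) :
    HasProjectiveDimensionLT (ModuleCat.of (MvPolynomial V k)
      (MvPolynomial V k ⧸ nonfaceIdeal V Δ k)) 0 := by
  have : Subsingleton (MvPolynomial V k ⧸ nonfaceIdeal V Δ k) :=
    Ideal.Quotient.subsingleton_iff.2 (nonfaceIdeal_eq_top_of_faces_eq_empty h)
  exact (ModuleCat.isZero_of_subsingleton _).hasProjectiveDimensionLT_zero

/-- For a vertex decomposable complex, the projective dimension of the Stanley-Reisner ring is
bounded by the maximal number of vertices in the complement of a facet. -/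
theorem VertexDecomposable.hasProjectiveDimensionLT (hΔ : Δ.VertexDecomposable)
    (hfin : Δ.vertices.Finite) (hV : Δ.vertices ⊆ V) {n : ℕ}
    (hn : ∀ F ∈ Δ.facets, (Δ.vertices \ F).ncard < n) :
    HasProjectiveDimensionLT (ModuleCat.of (MvPolynomial V k)
      (MvPolynomial V k ⧸ nonfaceIdeal V Δ k)) n := by
  induction hΔ generalizing n with
  | simplex Δ h =>
    have hbot : nonfaceIdeal V Δ k = ⊥ := by
      rw [eq_bot_iff]
      refine Ideal.span_le.2 ?_
      rintro _ ⟨F, h₁, h₂, rfl⟩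
      have hface : Δ.vertices ∈ Δ.facets := h ▸ rfl
      exact absurd (Δ.down_closed _ hface.prop _ h₁) h₂
    have := Module.Projective.of_equiv (Submodule.quotEquivOfEqBot (nonfaceIdeal V Δ k) hbot).symm
    have : Projective (ModuleCat.of (MvPolynomial V k) (MvPolynomial V k ⧸ nonfaceIdeal V Δ k)) :=
      ModuleCat.projective_of_categoryTheory_projective _
    have hpos : 1 ≤ n := (Nat.zero_le _).trans_lt (hn Δ.vertices (h ▸ rfl))
    exact hasProjectiveDimensionLT_of_ge _ 1 n hpos
  | void Δ h =>
    have := hasProjectiveDimensionLT_zero_of_faces_eq_empty (V := V) (k := k) h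
    exact hasProjectiveDimensionLT_of_ge _ 0 n n.zero_le
  | shed Δ x hx hdel hlink ihdel ihlink =>
    -- The deletion needs the bound `n - 1`. If `n = 0`, there are no facets, so the complex is void
    -- and the module is zero.
    obtain _ | n := n
    · refine hasProjectiveDimensionLT_zero_of_faces_eq_empty
        (faces_eq_empty_of_facets_eq_empty hfin ?_)
      exact Set.eq_empty_iff_forall_notMem.2 fun F hF => (hn F hF).not_ge (Nat.zero_le _)
    have hfin' : (Δ.vertices \ {x}).Finite := hfin.sdiff
    have hV' : Δ.vertices \ {x} ⊆ V := Set.sdiff_subset.trans hV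
    have hlt_link : ∀ F ∈ (Δ.link x).facets, ((Δ.link x).vertices \ F).ncard < n + 1 := by
      intro F hF
      have heq : (Δ.link x).vertices \ F = Δ.vertices \ insert x F := by
        change (Δ.vertices \ {x}) \ F = _
        rw [Set.sdiff_sdiff, Set.singleton_union]
      rw [heq]
      exact hn _ (insert_mem_facets_of_mem_facets_link hF)
    -- By shedding, `F` is a facet of `Δ` missing `x`; dropping `x` from its complement gains the
    -- one that adjoining `X y` will cost.
    have hlt_del : ∀ F ∈ (Δ.del x).facets, ((Δ.del x).vertices \ F).ncard < n := by
      intro F hF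
      have heq : (Δ.del x).vertices \ F = (Δ.vertices \ F) \ {x} := by
        change (Δ.vertices \ {x}) \ F = _
        rw [Set.sdiff_sdiff_comm]
      have hcard := Set.ncard_sdiff_singleton_add_one
        (show x ∈ Δ.vertices \ F from ⟨hx.1, hF.prop.2⟩) hfin.sdiff
      have := hn F (hx.2 F hF)
      rw [heq]
      omega
    let y : V := ⟨x, hV hx.1⟩
    have hy : y.1 ∉ (Δ.del x).vertices := fun h => h.2 rfl
    refine hasProjectiveDimensionLT_of_colon (X_mul_mem_nonfaceIdeal_iff_link (x := y) hx.1)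
      (nonfaceIdeal_del_sup_span_X Δ k y) (ihlink hfin' hV' hlt_link) ?_
    exact hasProjectiveDimensionLT_sup_span_singleton
      (X_mul_mem_nonfaceIdeal_iff_of_notMem hy) (ihdel hfin' hV' hlt_del)

end SimpComplex

/-! ### Facet complements as flower sets -/

namespace Hypergraph

variable {α : Type*} {H : Hypergraph α}

theorem BouquetSet.flowers_subset_vertexSet (𝓑 : H.BouquetSet) : 𝓑.flowers ⊆ H.vertexSet := by
  refine Set.iUnion₂_subset fun B hB => Set.sdiff_subset.trans (Set.sUnion_subset fun E hE => ?_)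
  exact H.subset_vertexSet_of_mem_edgeSet' ((𝓑.isBouquet B hB).1 hE)

theorem BouquetSet.SemiStronglyDisjoint.ncard_flowers_le_dPrime (hfin : H.vertexSet.Finite)
    {𝓑 : H.BouquetSet} (h𝓑 : 𝓑.SemiStronglyDisjoint) : 𝓑.flowers.ncard ≤ H.dPrime := by
  refine le_csSup ⟨H.vertexSet.ncard, ?_⟩ ⟨𝓑, h𝓑, rfl⟩
  rintro _ ⟨𝓒, -, rfl⟩
  exact Set.ncard_le_ncard 𝓒.flowers_subset_vertexSet hfin

/-- Every vertex outside a maximal independent set `F` is on an edge that is otherwise inside `F`. -/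
theorem exists_edge_of_mem_facets {F : Set α} (hF : F ∈ H.independenceComplex.facets) {v : α}
    (hv : v ∈ H.vertexSet \ F) : ∃ E ∈ H.edgeSet, v ∈ E ∧ E \ {v} ⊆ F := by
  have hFi : H.IsIndep F := hF.prop
  by_contra! hcon
  refine hv.2 (hF.le_of_ge (y := insert v F) ?_ (Set.subset_insert v F) (Set.mem_insert v F))
  refine ⟨Set.insert_subset hv.1 hFi.1, fun E hE hEF => ?_⟩
  by_cases hvE : v ∈ E
  · exact hcon E hE hvE (Set.sdiff_singleton_subset_iff.2 hEF)
  · exact hFi.2 E hE ((Set.subset_insert_iff_of_notMem hvE).1 hEF)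

/-- The complement of a facet is the set of flowers of a semi-strongly disjoint set of bouquets with
one stem each. -/
theorem exists_semiStronglyDisjoint_flowers_eq {F : Set α}
    (hF : F ∈ H.independenceComplex.facets) :
    ∃ 𝓑 : H.BouquetSet, 𝓑.SemiStronglyDisjoint ∧ 𝓑.flowers = H.vertexSet \ F := by
  have hFi : H.IsIndep F := hF.prop
  choose! E hE hvE hEF using fun v (hv : v ∈ H.vertexSet \ F) => exists_edge_of_mem_facets hF hv
  have hinter : ∀ v ∈ H.vertexSet \ F, E v ∩ F = E v \ {v} := fun v hv =>
    Set.Subset.antisymm (fun w hw => ⟨hw.1, fun h => hv.2 (h ▸ hw.2)⟩)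
      (fun w hw => ⟨hw.1, hEF v hv hw⟩)
  let 𝓑 : H.BouquetSet :=
    { bouquets := {B | ∃ v ∈ H.vertexSet \ F, B = {E v}}
      -- Roots may depend only on the stems, not on `v`; for `B = {E v}` this set is `E v \ {v}`,
      -- leaving `v` as the only flower.
      root := fun B => ⋃₀ B ∩ F
      isBouquet := by
        rintro _ ⟨v, hv, rfl⟩
        exact ⟨Set.singleton_subset_iff.2 (hE v hv), Set.singleton_nonempty _, v,
          by simpa using hvE v hv⟩
      isRootSet := by
        rintro _ ⟨v, hv, rfl⟩
        refine Or.inr ⟨E v, rfl, ?_, ?_⟩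
        · rw [Set.sUnion_singleton, hinter v hv]
          exact Set.sdiff_singleton_ssubset.2 (hvE v hv)
        · rw [Set.sUnion_singleton, hinter v hv]
          -- The root set is empty only if `E v = {v}`, the permitted exception.
          refine (Set.eq_empty_or_nonempty (E v \ {v})).symm.imp_right fun h => ⟨v, ?_⟩
          exact Set.Subset.antisymm (Set.sdiff_eq_empty.1 h)
            (Set.singleton_subset_iff.2 (hvE v hv)) }
  refine ⟨𝓑, ?_, Set.Subset.antisymm ?_ fun v hv => ?_⟩
  · exact H.independenceComplex.down_closed F hF.prop _
      (Set.iUnion₂_subset fun B _ => Set.inter_subset_right)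
  · intro w hw
    obtain ⟨B, hB, hwB, hwr⟩ := Set.mem_iUnion₂.1 hw
    exact ⟨𝓑.flowers_subset_vertexSet hw, fun hwF => hwr ⟨hwB, hwF⟩⟩
  · exact Set.mem_iUnion₂.2 ⟨{E v}, ⟨v, hv, rfl⟩, by simpa using hvE v hv, fun h => hv.2 h.2⟩

end Hypergraph

theorem mainTheorem8 {α : Type*} {k : Type*} [Field k] (H : Hypergraph α)
    (hfin : H.vertexSet.Finite) (hsimple : H.IsSimple) (hvd : H.IsVertexDecomposable) :
    CategoryTheory.projectiveDimension
      (ModuleCat.of (MvPolynomial H.independenceComplex.vertices k)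
        (MvPolynomial H.independenceComplex.vertices k ⧸
          H.independenceComplex.stanleyReisnerIdeal k)) ≤ (H.dPrime : WithBot ℕ∞) := by
  -- Dimension at most `d` becomes `HasProjectiveDimensionLT` at `d + 1`, matching the strict bound
  -- on facet complements.
  rw [projectiveDimension_le_iff, SimpComplex.stanleyReisnerIdeal_eq_nonfaceIdeal]
  refine hvd.hasProjectiveDimensionLT hfin subset_rfl fun F hF => Nat.lt_succ_of_le ?_
  obtain ⟨𝓑, h𝓑, hflowers⟩ := Hypergraph.exists_semiStronglyDisjoint_flowers_eq hF
  exact hflowers ▸ h𝓑.ncard_flowers_le_dPrime hfin
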